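/- Let $K$ be an algebraically closed field that is complete with respect to a nontrivial non-Archimedean absolute value $|\cdot|$, and let $p>1$ be the base of the logarithms (for $K=\mathbb{C}_p$, the prime $p$). An open ball of $\mathbb{P}^1=\mathbb{P}^1(K)$ is a usual open ball $B(a,r)=\{x\in K:|x-a|<r\}$, $r>0$, or the complement of a usual closed ball $B(a,r)^+=\{x\in K:|x-a|\le r\}$; the corresponding closed ball $B^+$ is $B(a,r)^+$, respectively $\mathbb{P}^1\setminus B(a,r)$. Let $\gamma_1,\dots,\gamma_g\in PGL(2,K)$ generate a Schottky group $\Gamma$ and be in good position: there are $2g$ open balls $B_1,\dots,B_g,B_1',\dots,B_g'$ of $\mathbb{P}^1$ whose corresponding closed balls are pairwise disjoint and which satisfy $\gamma_i(\mathbb{P}^1\setminus B_i')=B_i^+$ and $\gamma_i^{-1}(\mathbb{P}^1\setminus B_i)=B_i'^+$ for all $i$. Let $F$ be the complement of the union of these $2g$ open balls, and assume that $\infty$ lies in the interior of $F$, that is, in none of the $2g$ closed balls. Then all these balls are usual balls. Let $d$ be the minimum of the diameters of $B_1,\dots,B_g,B_1',\dots,B_g'$, and let $c$ be the minimum of the pairwise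 distances between the $2g$ points $P_1,\dots,P_g,P_1',\dots,P_g'$ of $(\mathbb{P}^1)^{an}$ given by the corresponding closed balls, where the distance between the points given by $B(a_1,r_1)^+$ and $B(a_2,r_2)^+$ is $\log_p(R/r_1)+\log_p(R/r_2)$, with $R=\max\{r_1,r_2,|a_1-a_2|\}$ the radius of the smallest closed ball containing both. Let $\Gamma_m$ be the set of elements of $\Gamma$ that are products of reduced words of length at most $m$ in $\gamma_1^{\pm1},\dots,\gamma_g^{\pm1}$. Fix $i$, let $a\in B_i'^+\setminus B_i'$, and put $$u_{\gamma_i}(w)=\prod_{\gamma\in\Gamma}\frac{w-\gamma a}{w-\gamma\gamma_i a}.$$ Let $z\in F\cap K$ with $z\notin\Gamma a$, and let $m\ge 1$ be an integer. Then $\gamma a\ne\infty$ for all $\gamma\in\Gamma$, the product $u_{\gamma_i}(w)$ converges for all $w$ near $z$, $u_{\gamma_i}$ is differentiable at $z$ with $u_{\gamma_i}(z)\neq 0$, and $$\left|\sum_{\gamma\in\Gamma_m}\frac{\gamma a-\gamma\gamma_i a}{(z-\gamma a)(z-\gamma\gamma_i a)}-\frac{u_{\gamma_i}'(z)}{u_{\gamma_i}(z)}\right|\le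 p^{-mc-\log_p(d)}.$$ -/

import Mathlib

open OnePoint Topology
open scoped MatrixGroups

namespace MumfordCurve

section Defs

variable {K : Type*} [NontriviallyNormedField K]

/-- An open ball of `ℙ¹(K) = K ∪ {∞}`, presented by a centre and a positive radius: either a usual
open ball `B(a, r)` (`disc`), or the complement of a usual closed ball `B(a, r)⁺` (`codisc`). -/
inductive ProjBall (K : Type*) where
  | disc (a : K) (r : ℝ) (hr : 0 < r)
  | codisc (a : K) (r : ℝ) (hr : 0 < r)

/-- The centre of the presentation of a ball. -/
def ProjBall.center : ProjBall K → K
  | disc a _ _ => a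
  | codisc a _ _ => a

/-- The radius of the presentation of a ball. -/
def ProjBall.radius : ProjBall K → ℝ
  | disc _ r _ => r
  | codisc _ r _ => r

/-- The open ball `B ⊆ ℙ¹(K)`. -/
def ProjBall.openBall : ProjBall K → Set (OnePoint K)
  | disc a r _ => (fun x : K => (x : OnePoint K)) '' Metric.ball a r
  | codisc a r _ => ((fun x : K => (x : OnePoint K)) '' Metric.closedBall a r)ᶜ

/-- The closed ball `B⁺ ⊆ ℙ¹(K)` corresponding to the open ball `B`. -/
def ProjBall.closedBall : ProjBall K → Set (OnePoint K)
  | disc a r _ => (fun x : K => (x : OnePoint K)) '' Metric.closedBall a r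
  | codisc a r _ => ((fun x : K => (x : OnePoint K)) '' Metric.ball a r)ᶜ

/-- The diameter of the part of the open ball `B` that lies in `K`. It is the diameter of `B` when
`∞ ∉ B`, the only case in which it is used. -/
noncomputable def ProjBall.diam (B : ProjBall K) : ℝ :=
  Metric.diam {x : K | (x : OnePoint K) ∈ B.openBall}

/-- The distance, in the tree of closed balls of `K` with base-`p` logarithmic lengths, between the
points given by the closed balls of `K` with the centres and radii of `B₁` and `B₂`. The smallest
closed ball containing both of them has radius `R = max (max r₁ r₂) ‖a₁ - a₂‖`, and the distance is
the length `logₚ (R / r₁)` of the path up from the first to that ball plus the length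
`logₚ (R / r₂)` of the path down to the second. -/
noncomputable def ProjBall.treeDist (p : ℝ) (B₁ B₂ : ProjBall K) : ℝ :=
  let R := max (max B₁.radius B₂.radius) ‖B₁.center - B₂.center‖
  Real.logb p (R / B₁.radius) + Real.logb p (R / B₂.radius)

/-- The family of the `2g` balls `B₁, …, B_g, B₁', …, B_g'`. -/
def allBalls {g : ℕ} (B B' : Fin g → ProjBall K) : Fin g ⊕ Fin g → ProjBall K :=
  Sum.elim B B'

/-- The domain `F`: the complement in `ℙ¹(K)` of the `2g` open balls. -/
def domain {g : ℕ} (B B' : Fin g → ProjBall K) : Set (OnePoint K) :=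
  (⋃ j, (allBalls B B' j).openBall)ᶜ

/-- The interior `F°`: the complement in `ℙ¹(K)` of the `2g` closed balls. -/
def domainInterior {g : ℕ} (B B' : Fin g → ProjBall K) : Set (OnePoint K) :=
  (⋃ j, (allBalls B B' j).closedBall)ᶜ

/-- The group `Γ` generated by the `γ i`. -/
def grp {g : ℕ} (γ : Fin g → PGL(2, K)) : Subgroup PGL(2, K) :=
  Subgroup.closure (Set.range γ)

/-- The element of the group given by a letter: `(i, true)` is `γᵢ`, and `(i, false)` is `γᵢ⁻¹`. -/
def letter {g : ℕ} (γ : Fin g → PGL(2, K)) (x : Fin g × Bool) : PGL(2, K) :=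
  if x.2 then γ x.1 else (γ x.1)⁻¹

/-- The set `Γₘ` of the products of the reduced words of length at most `m` in the `γᵢ^{±1}`. -/
def wordSet {g : ℕ} (γ : Fin g → PGL(2, K)) (m : ℕ) : Set PGL(2, K) :=
  {δ | ∃ w : List (Fin g × Bool),
    FreeGroup.IsReduced w ∧ w.length ≤ m ∧ (w.map (letter γ)).prod = δ}

theorem wordSet_finite {g : ℕ} (γ : Fin g → PGL(2, K)) (m : ℕ) : (wordSet γ m).Finite := by
  refine ((List.finite_length_le (Fin g × Bool) m).image
    fun w => (w.map (letter γ)).prod).subset ?_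
  rintro δ ⟨w, -, hw, rfl⟩
  exact ⟨w, hw, rfl⟩

variable [DecidableEq K]

/-- `PGL(2, K)` acts on `ℙ¹(K)` by fractional linear transformations, through the action of
`GL(2, K)`. -/
noncomputable instance instPGLAction : MulAction PGL(2, K) (OnePoint K) :=
  Matrix.ProjGenLinGroup.mulActionOfGL (by
    intro u x
    induction x using OnePoint.rec with
    | infty => simp [OnePoint.smul_infty_eq_ite]
    | coe x =>
      have hu : (u : K) ≠ 0 := u.ne_zero
      simp [OnePoint.smul_some_eq_ite, hu])

/-- The complement of the open balls `B i`, `B' i` is a good fundamental domain corresponding to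
the elements `γ i`. -/
structure IsGoodFundamentalDomain {g : ℕ} (γ : Fin g → PGL(2, K)) (B B' : Fin g → ProjBall K) :
    Prop where
  /-- The `2g` closed balls are pairwise disjoint. -/
  disjoint : Pairwise fun j k =>
    Disjoint (allBalls B B' j).closedBall (allBalls B B' k).closedBall
  /-- `γᵢ (ℙ¹ \ Bᵢ') = Bᵢ⁺`. -/
  image : ∀ i, (fun x => γ i • x) '' ((B' i).openBall)ᶜ = (B i).closedBall
  /-- `γᵢ⁻¹ (ℙ¹ \ Bᵢ) = Bᵢ'⁺`. -/
  image_inv : ∀ i, (fun x => (γ i)⁻¹ • x) '' ((B i).openBall)ᶜ = (B' i).closedBall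

/-- The affine coordinate of a point of `ℙ¹(K)` other than `∞` (and `0` at `∞`). -/
def coord (x : OnePoint K) : K :=
  OnePoint.elim x 0 id

/-- The factor `(w - δa) / (w - δb)` of the theta function. -/
noncomputable def thetaFactor (a b : OnePoint K) (w : K) (δ : PGL(2, K)) : K :=
  (w - coord (δ • a)) / (w - coord (δ • b))

/-- The theta function `Θ(a, b; w) = ∏_{δ ∈ Γ} (w - δa) / (w - δb)`. -/
noncomputable def theta {g : ℕ} (γ : Fin g → PGL(2, K)) (a b : OnePoint K) (w : K) : K :=
  ∏' δ : grp γ, thetaFactor a b w δ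

/-- The function `u_α(w) = Θ(a, αa; w)`, formed with the base point `a`. -/
noncomputable def uFun {g : ℕ} (γ : Fin g → PGL(2, K)) (α : PGL(2, K)) (a : OnePoint K) (w : K) :
    K :=
  theta γ a (α • a) w

/-- The sum over `δ ∈ Γₘ` of `(δa - δαa) / ((w - δa) (w - δαa))`. -/
noncomputable def truncatedSum {g : ℕ} (γ : Fin g → PGL(2, K)) (m : ℕ) (α : PGL(2, K))
    (a : OnePoint K) (w : K) : K :=
  ∑ δ ∈ (wordSet_finite γ m).toFinset,
    (coord (δ • a) - coord (δ • α • a)) / ((w - coord (δ • a)) * (w - coord (δ • α • a)))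

end Defs

end MumfordCurve

/-!
A reduced word maps `F` into the ball targeted by its first letter. Each letter sends `ℙ¹ \ D`
into a ball `E`, so in coordinates it is `u ↦ e + k / (u - s)` with `s` in `D` and `|k| ≤ r_D r_E`
(here density of the value group is used); on a ball `T` disjoint from `D` it therefore multiplies
distances by at most `r_E r_D / |a_D - a_T|²`, which is `(r_E / r_T) p^(-t)` for `t` the tree
distance of `D` and `T`. Hence a word longer than `m` brings two points of `F` to within
`r p^(-mc)`, with `r ≥ d` the radius of the target ball, while both images stay at distance at least
`r` from `z`; the corresponding term of the logarithmic derivative is at most `p^(-mc) / d`. Since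
the absolute value is ultrametric, the product converges as soon as its factors tend to `1`, it
can be differentiated termwise, and the tail of a series is bounded by its largest term.
-/

namespace MumfordCurve

open Filter Set

section Ultrametric

variable {ι : Type*} {ε : ℝ}

theorem exists_finset_norm_le_of_tendsto_cofinite {E : Type*} [SeminormedAddCommGroup E]
    {f : ι → E} (hf : Tendsto f cofinite (𝓝 0)) (hε : 0 < ε) :
    ∃ s : Finset ι, ∀ i ∉ s, ‖f i‖ ≤ ε := by
  have hfin : {i | ¬‖f i‖ ≤ ε}.Finite :=
    eventually_cofinite.1 (hf.norm.eventually_le_const (by simpa using hε))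
  exact ⟨hfin.toFinset, fun i hi => by simpa using hi⟩

theorem norm_add_le_of_le_of_le {E : Type*} [SeminormedAddCommGroup E] [IsUltrametricDist E]
    {x y : E} (hx : ‖x‖ ≤ ε) (hy : ‖y‖ ≤ ε) : ‖x + y‖ ≤ ε :=
  (IsUltrametricDist.norm_add_le_max x y).trans (max_le hx hy)

theorem norm_sub_eq_of_norm_sub_lt {E : Type*} [SeminormedAddCommGroup E] [IsUltrametricDist E]
    {u w z : E} (h : ‖w - z‖ < ‖u - z‖) : ‖u - w‖ = ‖u - z‖ := by
  rw [norm_sub_rev w z] at h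
  simpa [max_eq_left h.le] using IsUltrametricDist.norm_add_eq_max_of_norm_ne_norm h.ne'

variable {K : Type*} [NormedField K] [IsUltrametricDist K] {f : ι → K}

theorem norm_one_add_eq_one {x : K} (h : ‖x‖ < 1) : ‖1 + x‖ = 1 := by
  have hne : ‖(1 : K)‖ ≠ ‖x‖ := by simpa using h.ne'
  simpa [h.le] using IsUltrametricDist.norm_add_eq_max_of_norm_ne_norm hne

theorem norm_prod_one_add_eq_of_subset {s t : Finset ι} (hst : s ⊆ t)
    (hf : ∀ i ∉ s, ‖f i‖ < 1) : ‖∏ i ∈ t, (1 + f i)‖ = ‖∏ i ∈ s, (1 + f i)‖ := by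
  rw [norm_prod, norm_prod]
  exact (Finset.prod_subset hst fun i _ hi => norm_one_add_eq_one (hf i hi)).symm

theorem norm_prod_one_add_sub_one_le {s : Finset ι} (h0 : 0 ≤ ε) (h1 : ε ≤ 1)
    (hf : ∀ i ∈ s, ‖f i‖ ≤ ε) : ‖∏ i ∈ s, (1 + f i) - 1‖ ≤ ε := by
  induction s using Finset.cons_induction with
  | empty => simpa using h0
  | cons a s ha ih =>
    obtain ⟨hfa, hfs⟩ := (Finset.forall_mem_cons ha _).1 hf
    have hsplit : ∏ i ∈ s.cons a ha, (1 + f i) - 1 =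
        (∏ i ∈ s, (1 + f i) - 1) + (f a + f a * (∏ i ∈ s, (1 + f i) - 1)) := by
      rw [Finset.prod_cons]
      ring
    have hcross : ‖f a * (∏ i ∈ s, (1 + f i) - 1)‖ ≤ ε := by
      rw [norm_mul]
      exact (mul_le_of_le_one_right (norm_nonneg _) ((ih hfs).trans h1)).trans hfa
    rw [hsplit]
    exact norm_add_le_of_le_of_le (ih hfs) (norm_add_le_of_le_of_le hfa hcross)

theorem norm_prod_one_add_sub_one_sub_sum_le {s : Finset ι} (h0 : 0 ≤ ε) (h1 : ε ≤ 1)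
    (hf : ∀ i ∈ s, ‖f i‖ ≤ ε) : ‖∏ i ∈ s, (1 + f i) - 1 - ∑ i ∈ s, f i‖ ≤ ε ^ 2 := by
  induction s using Finset.cons_induction with
  | empty => simpa using sq_nonneg ε
  | cons a s ha ih =>
    obtain ⟨hfa, hfs⟩ := (Finset.forall_mem_cons ha _).1 hf
    have hsplit : ∏ i ∈ s.cons a ha, (1 + f i) - 1 - ∑ i ∈ s.cons a ha, f i =
        (∏ i ∈ s, (1 + f i) - 1 - ∑ i ∈ s, f i) + f a * (∏ i ∈ s, (1 + f i) - 1) := by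
      rw [Finset.prod_cons, Finset.sum_cons]
      ring
    have hcross : ‖f a * (∏ i ∈ s, (1 + f i) - 1)‖ ≤ ε ^ 2 := by
      rw [norm_mul, sq]
      exact mul_le_mul hfa (norm_prod_one_add_sub_one_le h0 h1 hfs) (norm_nonneg _) h0
    rw [hsplit]
    exact norm_add_le_of_le_of_le (ih hfs) hcross

theorem exists_finset_norm_prod_one_add_eq (hf : Tendsto f cofinite (𝓝 0)) :
    ∃ s : Finset ι, ∀ t, s ⊆ t → ‖∏ i ∈ t, (1 + f i)‖ = ‖∏ i ∈ s, (1 + f i)‖ := by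
  obtain ⟨s, hs⟩ := exists_finset_norm_le_of_tendsto_cofinite hf one_half_pos
  exact ⟨s, fun t hst => norm_prod_one_add_eq_of_subset hst fun i hi =>
    (hs i hi).trans_lt one_half_lt_one⟩

variable [CompleteSpace K]

theorem multipliable_one_add_of_tendsto_cofinite (hf : Tendsto f cofinite (𝓝 0)) :
    Multipliable fun i => 1 + f i := by
  classical
  obtain ⟨s, hs⟩ := exists_finset_norm_prod_one_add_eq hf
  refine cauchySeq_tendsto_of_complete (Metric.cauchySeq_iff'.2 fun ε hε => ?_)
  set C := ‖∏ i ∈ s, (1 + f i)‖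
  obtain ⟨η, hη0, hη⟩ : ∃ η > 0, η * C < ε := exists_pos_mul_lt hε C |>.imp fun η h => by
    rwa [mul_comm C] at h
  obtain ⟨s', hs'⟩ := exists_finset_norm_le_of_tendsto_cofinite hf (lt_min one_pos hη0)
  refine ⟨s ∪ s', fun t ht => ?_⟩
  have hle : ‖∏ i ∈ t \ (s ∪ s'), (1 + f i) - 1‖ ≤ min 1 η :=
    norm_prod_one_add_sub_one_le (by positivity) (min_le_left _ _) fun i hi =>
      hs' i fun h => (Finset.mem_sdiff.1 hi).2 (Finset.mem_union_right _ h)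
  calc dist (∏ i ∈ t, (1 + f i)) (∏ i ∈ s ∪ s', (1 + f i))
      = ‖∏ i ∈ t \ (s ∪ s'), (1 + f i) - 1‖ * C := by
        rw [dist_eq_norm, ← Finset.prod_sdiff ht, ← sub_one_mul, norm_mul,
          hs _ Finset.subset_union_left]
    _ ≤ η * C := by gcongr; exact hle.trans (min_le_right _ _)
    _ < ε := hη

theorem tprod_one_add_ne_zero_of_tendsto_cofinite (hf : Tendsto f cofinite (𝓝 0))
    (h0 : ∀ i, 1 + f i ≠ 0) : ∏' i, (1 + f i) ≠ 0 := by
  obtain ⟨s, hs⟩ := exists_finset_norm_prod_one_add_eq hf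
  have hnorm : ‖∏' i, (1 + f i)‖ = ‖∏ i ∈ s, (1 + f i)‖ := by
    refine tendsto_nhds_unique (Tendsto.norm (multipliable_one_add_of_tendsto_cofinite hf).hasProd)
      (tendsto_const_nhds.congr' ?_)
    filter_upwards [eventually_ge_atTop s] with t ht using (hs t ht).symm
  rw [← norm_ne_zero_iff, hnorm, norm_ne_zero_iff]
  exact Finset.prod_ne_zero_iff.2 fun i _ => h0 i

theorem norm_tprod_one_add_sub_one_sub_tsum_le (hf : Tendsto f cofinite (𝓝 0)) (h0 : 0 ≤ ε)
    (h1 : ε ≤ 1) (hfε : ∀ i, ‖f i‖ ≤ ε) : ‖∏' i, (1 + f i) - 1 - ∑' i, f i‖ ≤ ε ^ 2 := by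
  have hprod := (multipliable_one_add_of_tendsto_cofinite hf).hasProd
  have hsum := (NonarchimedeanAddGroup.summable_of_tendsto_cofinite_zero hf).hasSum
  have hlim : Tendsto (fun s => ∏ i ∈ s, (1 + f i) - 1 - ∑ i ∈ s, f i) atTop
      (𝓝 (∏' i, (1 + f i) - 1 - ∑' i, f i)) := (hprod.sub_const 1).sub hsum
  exact le_of_tendsto hlim.norm (.of_forall fun s =>
    norm_prod_one_add_sub_one_sub_sum_le h0 h1 fun i _ => hfε i)

theorem norm_sum_sub_tsum_le (hf : Tendsto f cofinite (𝓝 0)) (h0 : 0 ≤ ε) {s : Finset ι}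
    (hfs : ∀ i ∉ s, ‖f i‖ ≤ ε) : ‖∑ i ∈ s, f i - ∑' i, f i‖ ≤ ε := by
  rw [← (NonarchimedeanAddGroup.summable_of_tendsto_cofinite_zero hf).sum_add_tsum_compl (s := s),
    sub_add_cancel_left, norm_neg]
  exact IsUltrametricDist.norm_tsum_le_of_forall_le_of_nonneg h0 fun i => hfs i i.2

theorem tendsto_tsum_of_tendstoUniformly {α : Type*} {F : α → ι → K} {l : Filter α}
    (hF : TendstoUniformly F f l) (hF0 : ∀ᶠ a in l, Tendsto (F a) cofinite (𝓝 0))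
    (hf : Tendsto f cofinite (𝓝 0)) : Tendsto (fun a => ∑' i, F a i) l (𝓝 (∑' i, f i)) := by
  rw [Metric.tendsto_nhds]
  intro ε hε
  filter_upwards [hF0, Metric.tendstoUniformly_iff.1 hF (ε / 2) (half_pos hε)] with a ha hclose
  have hdiff : ‖∑' i, F a i - ∑' i, f i‖ ≤ ε / 2 := by
    rw [← (NonarchimedeanAddGroup.summable_of_tendsto_cofinite_zero ha).tsum_sub
      (NonarchimedeanAddGroup.summable_of_tendsto_cofinite_zero hf)]
    refine IsUltrametricDist.norm_tsum_le_of_forall_le_of_nonneg (half_pos hε).le fun i => ?_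
    rw [← dist_eq_norm, dist_comm]
    exact (hclose i).le
  rw [dist_eq_norm]
  exact hdiff.trans_lt (half_lt_self hε)

end Ultrametric

section ProductOfQuotients

variable {K ι : Type*} [NormedField K] {x y : ι → K} {z w : K} {ρ : ℝ}

theorem tendsto_div_cofinite_zero {u v : ι → K} (hu : Tendsto u cofinite (𝓝 0)) (hρ : 0 < ρ)
    (hv : ∀ i, ρ ≤ ‖v i‖) : Tendsto (fun i => u i / v i) cofinite (𝓝 0) := by
  refine squeeze_zero_norm (fun i => ?_) (by simpa using hu.norm.div_const ρ)
  rw [norm_div]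
  gcongr
  exact hv i

theorem le_norm_mul {a b : K} (hρ : 0 < ρ) (ha : ρ ≤ ‖a‖) (hb : ρ ≤ ‖b‖) : ρ * ρ ≤ ‖a * b‖ := by
  rw [norm_mul]
  gcongr

theorem ne_zero_of_le_norm {a : K} (hρ : 0 < ρ) (ha : ρ ≤ ‖a‖) : a ≠ 0 :=
  norm_pos_iff.1 (hρ.trans_le ha)

theorem div_eq_one_add_neg {a b : K} (hb : w - b ≠ 0) :
    (w - a) / (w - b) = 1 + -((a - b) / (w - b)) := by
  field_simp
  ring

variable [IsUltrametricDist K]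

theorem le_norm_sub_of_mem_ball {u : K} (hu : ρ ≤ ‖z - u‖) (hw : w ∈ Metric.ball z ρ) :
    ρ ≤ ‖w - u‖ := by
  rw [norm_sub_rev] at hu ⊢
  rwa [norm_sub_eq_of_norm_sub_lt ((mem_ball_iff_norm.1 hw).trans_le hu)]

theorem tendstoUniformly_div_mul (hρ : 0 < ρ) {N : ℝ} (hN0 : 0 ≤ N) (hN : ∀ i, ‖x i - y i‖ ≤ N)
    (hx : ∀ i, ρ ≤ ‖z - x i‖) (hy : ∀ i, ρ ≤ ‖z - y i‖) :
    TendstoUniformly (fun w i => (x i - y i) / ((z - x i) * (w - y i)))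
      (fun i => (x i - y i) / ((z - x i) * (z - y i))) (𝓝 z) := by
  rw [Metric.tendstoUniformly_iff]
  intro ε hε
  have hlim : Tendsto (fun w => N / (ρ * ρ) * (‖w - z‖ / ρ)) (𝓝 z) (𝓝 0) :=
    Continuous.tendsto' (by fun_prop) _ _ (by simp)
  filter_upwards [Metric.ball_mem_nhds z hρ, hlim.eventually_lt_const hε] with w hw hwε i
  have hwy : ρ ≤ ‖w - y i‖ := le_norm_sub_of_mem_ball (hy i) hw
  have hzx0 := ne_zero_of_le_norm hρ (hx i)
  have hzy0 := ne_zero_of_le_norm hρ (hy i)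
  have hwy0 := ne_zero_of_le_norm hρ hwy
  have hdiff : (x i - y i) / ((z - x i) * (z - y i)) - (x i - y i) / ((z - x i) * (w - y i)) =
      (x i - y i) / ((z - x i) * (z - y i)) * ((w - z) / (w - y i)) := by
    field_simp
    ring
  refine lt_of_le_of_lt ?_ hwε
  rw [dist_eq_norm, hdiff, norm_mul, norm_div, norm_div (w - z)]
  gcongr
  exacts [hN i, le_norm_mul hρ (hx i) (hy i)]

variable [CompleteSpace K]

theorem multipliable_div_of_tendsto (hxy : Tendsto (fun i => x i - y i) cofinite (𝓝 0))
    (hρ : 0 < ρ) (hy : ∀ i, ρ ≤ ‖w - y i‖) : Multipliable fun i => (w - x i) / (w - y i) := by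
  simp_rw [fun i => div_eq_one_add_neg (a := x i) (ne_zero_of_le_norm hρ (hy i))]
  exact multipliable_one_add_of_tendsto_cofinite
    (by simpa using (tendsto_div_cofinite_zero hxy hρ hy).neg)

theorem tprod_div_ne_zero_of_tendsto (hxy : Tendsto (fun i => x i - y i) cofinite (𝓝 0))
    (hρ : 0 < ρ) (hx : ∀ i, w ≠ x i) (hy : ∀ i, ρ ≤ ‖w - y i‖) :
    ∏' i, (w - x i) / (w - y i) ≠ 0 := by
  have hy0 : ∀ i, w - y i ≠ 0 := fun i => ne_zero_of_le_norm hρ (hy i)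
  simp_rw [fun i => div_eq_one_add_neg (a := x i) (hy0 i)]
  refine tprod_one_add_ne_zero_of_tendsto_cofinite
    (by simpa using (tendsto_div_cofinite_zero hxy hρ hy).neg) fun i => ?_
  rw [← div_eq_one_add_neg (hy0 i)]
  exact div_ne_zero (sub_ne_zero.2 (hx i)) (hy0 i)

theorem tprod_div_eq_mul_tprod (hxy : Tendsto (fun i => x i - y i) cofinite (𝓝 0))
    (hρ : 0 < ρ) (hx : ∀ i, ρ ≤ ‖z - x i‖) (hy : ∀ i, ρ ≤ ‖z - y i‖) (hw : w ∈ Metric.ball z ρ) :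
    ∏' i, (w - x i) / (w - y i) = (∏' i, (z - x i) / (z - y i)) *
      ∏' i, (1 + (w - z) * ((x i - y i) / ((z - x i) * (w - y i)))) := by
  have hyw : ∀ i, ρ ≤ ‖w - y i‖ := fun i => le_norm_sub_of_mem_ball (hy i) hw
  have hdecay := tendsto_div_cofinite_zero hxy (mul_pos hρ hρ)
    fun i => le_norm_mul hρ (hx i) (hyw i)
  rw [← (multipliable_div_of_tendsto hxy hρ hy).tprod_mul
    (multipliable_one_add_of_tendsto_cofinite (by simpa using hdecay.const_mul (w - z)))]
  refine tprod_congr fun i => ?_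
  have hzx := ne_zero_of_le_norm hρ (hx i)
  have hzy := ne_zero_of_le_norm hρ (hy i)
  have hwy := ne_zero_of_le_norm hρ (hyw i)
  field_simp
  ring

end ProductOfQuotients

section Derivative

variable {K ι : Type*} [NontriviallyNormedField K] [IsUltrametricDist K] [CompleteSpace K] {z : K}

theorem hasDerivAt_tprod_one_add_sub_mul {F : K → ι → K} {z S : K} {M : ℝ} (hM0 : 0 ≤ M)
    (hF0 : ∀ᶠ w in 𝓝 z, Tendsto (F w) cofinite (𝓝 0)) (hM : ∀ᶠ w in 𝓝 z, ∀ i, ‖F w i‖ ≤ M)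
    (hS : Tendsto (fun w => ∑' i, F w i) (𝓝 z) (𝓝 S)) :
    HasDerivAt (fun w => ∏' i, (1 + (w - z) * F w i)) S z := by
  have hsmall : ∀ᶠ w in 𝓝 z, ‖w - z‖ * M ≤ 1 := by
    have hlim : Tendsto (fun w => ‖w - z‖ * M) (𝓝 z) (𝓝 0) :=
      Continuous.tendsto' (by fun_prop) _ _ (by simp)
    exact hlim.eventually_le_const one_pos
  have hquad : (fun w => ∏' i, (1 + (w - z) * F w i) - 1 - (w - z) * ∑' i, F w i) =o[𝓝 z]
      fun w => w - z := by
    refine Asymptotics.IsBigO.trans_isLittleO (g := fun w => ‖w - z‖ ^ 2)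
      (.of_bound (M ^ 2) ?_) (Asymptotics.isLittleO_pow_sub_sub z one_lt_two)
    filter_upwards [hF0, hM, hsmall] with w hw0 hwM hw
    rw [← tsum_mul_left, norm_pow, norm_norm, ← mul_pow, mul_comm M]
    refine norm_tprod_one_add_sub_one_sub_tsum_le (by simpa using hw0.const_mul (w - z))
      (by positivity) hw fun i => ?_
    rw [norm_mul]
    gcongr
    exact hwM i
  have hlin : (fun w => (w - z) * (∑' i, F w i - S)) =o[𝓝 z] fun w => w - z := by
    simpa using (Asymptotics.isBigO_refl (fun w => w - z) (𝓝 z)).mul_isLittleO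
      ((Asymptotics.isLittleO_one_iff K).2 (tendsto_sub_nhds_zero_iff.2 hS))
  rw [hasDerivAt_iff_isLittleO]
  refine (hquad.add hlin).congr_left fun w => ?_
  simp only [sub_self, zero_mul, add_zero, tprod_one, smul_eq_mul]
  ring

theorem hasDerivAt_tprod_div_of_tendsto {x y : ι → K} {ρ : ℝ}
    (hxy : Tendsto (fun i => x i - y i) cofinite (𝓝 0))
    (hρ : 0 < ρ) (hx : ∀ i, ρ ≤ ‖z - x i‖) (hy : ∀ i, ρ ≤ ‖z - y i‖) :
    HasDerivAt (fun w => ∏' i, (w - x i) / (w - y i))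
      ((∏' i, (z - x i) / (z - y i)) * ∑' i, (x i - y i) / ((z - x i) * (z - y i))) z := by
  obtain ⟨N, hN⟩ := hxy.norm.bddAbove_range_of_cofinite
  have hN' : ∀ i, ‖x i - y i‖ ≤ max N 0 := fun i => (hN (mem_range_self i)).trans (le_max_left _ _)
  have hball := Metric.ball_mem_nhds z hρ
  have hden : ∀ w ∈ Metric.ball z ρ, ∀ i, ρ * ρ ≤ ‖(z - x i) * (w - y i)‖ := fun w hw i =>
    le_norm_mul hρ (hx i) (le_norm_sub_of_mem_ball (hy i) hw)
  have hdecay : ∀ w ∈ Metric.ball z ρ,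
      Tendsto (fun i => (x i - y i) / ((z - x i) * (w - y i))) cofinite (𝓝 0) := fun w hw =>
    tendsto_div_cofinite_zero hxy (mul_pos hρ hρ) (hden w hw)
  have hbound : ∀ w ∈ Metric.ball z ρ, ∀ i,
      ‖(x i - y i) / ((z - x i) * (w - y i))‖ ≤ max N 0 / (ρ * ρ) := fun w hw i => by
    rw [norm_div]
    gcongr
    exacts [hN' i, hden w hw i]
  refine HasDerivAt.congr_of_eventuallyEq (HasDerivAt.const_mul _
    (hasDerivAt_tprod_one_add_sub_mul (by positivity) (eventually_of_mem hball hdecay)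
      (eventually_of_mem hball hbound) (tendsto_tsum_of_tendstoUniformly
        (tendstoUniformly_div_mul hρ (le_max_right _ _) hN' hx hy)
        (eventually_of_mem hball hdecay) (hdecay z (Metric.mem_ball_self hρ))))) ?_
  filter_upwards [hball] with w hw using tprod_div_eq_mul_tprod hxy hρ hx hy hw

end Derivative

section Density

variable {K : Type*} [NontriviallyNormedField K] [IsAlgClosed K]

theorem exists_lt_norm_lt {r R : ℝ} (hr : 0 ≤ r) (hrR : r < R) : ∃ e : K, r < ‖e‖ ∧ ‖e‖ < R := by
  have hR : 0 < R := hr.trans_lt hrR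
  obtain ⟨b, hb0, hb1⟩ := NormedField.exists_norm_lt_one K
  obtain ⟨n, hn⟩ := exists_pow_lt_of_lt_one hb0 ((div_lt_one hR).2 hrR)
  have hn0 : n ≠ 0 := fun h => (hb1.trans_le (by simp [h])).not_gt hn
  obtain ⟨e, rfl⟩ := IsAlgClosed.exists_pow_nat_eq b hn0.bot_lt
  rw [norm_pow] at hn hb1
  have hre : r / R < ‖e‖ := lt_of_pow_lt_pow_left₀ n (norm_nonneg e) hn
  have he1 : ‖e‖ < 1 := (pow_lt_one_iff_of_nonneg (norm_nonneg e) hn0).1 hb1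
  obtain ⟨k, hk⟩ := exists_zpow_btwn_of_lt_mul ((div_lt_iff₀' hR).1 hre) hR
    ((div_nonneg hr hR.le).trans_lt hre) he1
  exact ⟨e ^ k, by rwa [norm_zpow]⟩

end Density

section Balls

theorem ProjBall.radius_pos {K : Type*} (D : ProjBall K) : 0 < D.radius := by
  cases D <;> assumption

variable {K : Type*} [NontriviallyNormedField K] {D E : ProjBall K} {x : OnePoint K} {p : ℝ}

theorem coe_coord (hx : x ≠ ∞) : ((coord x : K) : OnePoint K) = x := by
  lift x to K using hx
  rfl

theorem ProjBall.mem_closedBall_iff (hD : ∞ ∉ D.closedBall) (hx : x ≠ ∞) :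
    x ∈ D.closedBall ↔ ‖coord x - D.center‖ ≤ D.radius := by
  lift x to K using hx
  cases D with
  | disc a r hr => exact OnePoint.coe_injective.mem_set_image.trans mem_closedBall_iff_norm
  | codisc a r hr => exact absurd (by simp [ProjBall.closedBall]) hD

theorem ProjBall.mem_openBall_iff (hD : ∞ ∉ D.closedBall) (hx : x ≠ ∞) :
    x ∈ D.openBall ↔ ‖coord x - D.center‖ < D.radius := by
  lift x to K using hx
  cases D with
  | disc a r hr => exact OnePoint.coe_injective.mem_set_image.trans mem_ball_iff_norm
  | codisc a r hr => exact absurd (by simp [ProjBall.closedBall]) hD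

theorem ProjBall.openBall_subset_closedBall (D : ProjBall K) : D.openBall ⊆ D.closedBall := by
  cases D with
  | disc a r hr => exact image_mono Metric.ball_subset_closedBall
  | codisc a r hr => exact compl_subset_compl.2 (image_mono Metric.ball_subset_closedBall)

theorem ProjBall.setOf_coe_mem_openBall (hD : ∞ ∉ D.closedBall) :
    {u : K | (u : OnePoint K) ∈ D.openBall} = Metric.ball D.center D.radius := by
  ext u
  exact (mem_openBall_iff hD (coe_ne_infty u)).trans mem_ball_iff_norm.symm

theorem ProjBall.diam_pos (hD : ∞ ∉ D.closedBall) : 0 < D.diam := by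
  rw [diam, setOf_coe_mem_openBall hD]
  obtain ⟨e, he0, he⟩ := NormedField.exists_norm_lt K D.radius_pos
  refine Metric.diam_pos ⟨D.center, Metric.mem_ball_self D.radius_pos, D.center + e, ?_, ?_⟩
    Metric.isBounded_ball
  · simpa [mem_ball_iff_norm] using he
  · simpa [eq_comm] using he0

theorem ProjBall.max_radius_lt (hD : ∞ ∉ D.closedBall) (hE : ∞ ∉ E.closedBall)
    (h : Disjoint D.closedBall E.closedBall) :
    max D.radius E.radius < ‖D.center - E.center‖ := by
  have hDc : (D.center : OnePoint K) ∈ D.closedBall :=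
    (mem_closedBall_iff hD (coe_ne_infty _)).2 (by simpa [coord] using D.radius_pos.le)
  have hEc : (E.center : OnePoint K) ∈ E.closedBall :=
    (mem_closedBall_iff hE (coe_ne_infty _)).2 (by simpa [coord] using E.radius_pos.le)
  refine max_lt (lt_of_not_ge fun hle => ?_) (lt_of_not_ge fun hle => ?_)
  · exact disjoint_left.1 h ((mem_closedBall_iff hD (coe_ne_infty _)).2
      (by rwa [norm_sub_rev] at hle)) hEc
  · exact disjoint_left.1 h hDc ((mem_closedBall_iff hE (coe_ne_infty _)).2 hle)

theorem ProjBall.treeDist_eq (h : max D.radius E.radius < ‖D.center - E.center‖) :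
    D.treeDist p E = Real.logb p (‖D.center - E.center‖ ^ 2 / (D.radius * E.radius)) := by
  have hD := D.radius_pos
  have hE := E.radius_pos
  have hR : 0 < ‖D.center - E.center‖ := hD.trans ((le_max_left _ _).trans_lt h)
  rw [treeDist, max_eq_right h.le, ← Real.logb_mul (by positivity) (by positivity),
    div_mul_div_comm, ← sq]

theorem ProjBall.treeDist_pos (hp : 1 < p) (h : max D.radius E.radius < ‖D.center - E.center‖) :
    0 < D.treeDist p E := by
  have hD := D.radius_pos
  have hE := E.radius_pos
  obtain ⟨hDR, hER⟩ := max_lt_iff.1 h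
  rw [treeDist_eq h]
  refine Real.logb_pos hp ((one_lt_div (by positivity)).2 ?_)
  rw [sq]
  exact mul_lt_mul'' hDR hER hD.le hE.le

theorem ProjBall.radius_mul_radius_le (hp : 1 < p) {c : ℝ}
    (h : max D.radius E.radius < ‖D.center - E.center‖) (hc : c ≤ D.treeDist p E) :
    D.radius * E.radius ≤ p ^ (-c) * ‖D.center - E.center‖ ^ 2 := by
  have hD := D.radius_pos
  have hE := E.radius_pos
  have hR : 0 < ‖D.center - E.center‖ := hD.trans ((le_max_left _ _).trans_lt h)
  rw [treeDist_eq h, Real.le_logb_iff_rpow_le hp (by positivity), le_div_iff₀ (by positivity)] at hc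
  rwa [Real.rpow_neg (zero_le_one.trans hp.le), ← div_eq_inv_mul, le_div_iff₀' (by positivity)]

variable [IsUltrametricDist K]

theorem ProjBall.diam_le_radius (hD : ∞ ∉ D.closedBall) : D.diam ≤ D.radius := by
  rw [diam, setOf_coe_mem_openBall hD]
  refine Metric.diam_le_of_forall_dist_le D.radius_pos.le fun u hu v hv => ?_
  rw [IsUltrametricDist.ball_eq_of_mem hv] at hu
  exact (Metric.mem_ball.1 hu).le

theorem ProjBall.norm_coord_sub_coord_le (hD : ∞ ∉ D.closedBall) {y : OnePoint K}
    (hx : x ∈ D.closedBall) (hy : y ∈ D.closedBall) : ‖coord x - coord y‖ ≤ D.radius := by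
  rw [mem_closedBall_iff hD (ne_of_mem_of_not_mem hx hD)] at hx
  rw [mem_closedBall_iff hD (ne_of_mem_of_not_mem hy hD), norm_sub_rev] at hy
  simpa using norm_add_le_of_le_of_le hx hy

theorem ProjBall.norm_center_sub_coord_eq (hD : ∞ ∉ D.closedBall) (hE : ∞ ∉ E.closedBall)
    (hDE : Disjoint D.closedBall E.closedBall) (hx : x ∈ E.closedBall) :
    ‖D.center - coord x‖ = ‖D.center - E.center‖ :=
  norm_sub_eq_of_norm_sub_lt
    (((mem_closedBall_iff hE (ne_of_mem_of_not_mem hx hE)).1 hx).trans_lt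
      ((le_max_right _ _).trans_lt (max_radius_lt hD hE hDE)))

theorem ProjBall.radius_le_norm_sub_coord (hD : ∞ ∉ D.closedBall) {z : K}
    (hz : (z : OnePoint K) ∉ D.openBall) (hx : x ∈ D.openBall) : D.radius ≤ ‖z - coord x‖ := by
  have hxinf : x ≠ ∞ := ne_of_mem_of_not_mem (D.openBall_subset_closedBall hx) hD
  rw [mem_openBall_iff hD hxinf, ← mem_ball_iff_norm] at hx
  contrapose! hz
  rw [mem_openBall_iff hD (coe_ne_infty z), ← mem_ball_iff_norm,
    IsUltrametricDist.ball_eq_of_mem hx]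
  exact mem_ball_iff_norm.2 hz

end Balls

/-- The number `q ∈ [0, 1)` is a contraction rate of a family of usual balls if
`r_j r_k / |a_j - a_k|² ≤ q` for any two of them. When distances are measured in units of the radius
of the ball containing the points, this quotient bounds the factor by which a Möbius transformation
taking the complement of the `j`-th ball into another ball contracts distances in the `k`-th. -/
structure IsContractionRate {K ι : Type*} [NontriviallyNormedField K] (D : ι → ProjBall K) (q : ℝ) :
    Prop where
  nonneg : 0 ≤ q
  lt_one : q < 1
  radius_mul_le : ∀ j k, j ≠ k →
    (D j).radius * (D k).radius ≤ q * ‖(D j).center - (D k).center‖ ^ 2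

section Moebius

theorem exists_smul_coe_eq_add_div {K : Type*} [NontriviallyNormedField K] [DecidableEq K]
    {h : PGL(2, K)} (hinf : h • (∞ : OnePoint K) ≠ ∞) :
    ∃ A P κ : K, h • (∞ : OnePoint K) = A ∧ h • (P : OnePoint K) = ∞ ∧
      ∀ u : K, u ≠ P → h • (u : OnePoint K) = ((A + κ / (u - P) : K) : OnePoint K) := by
  obtain ⟨M, rfl⟩ : ∃ M : GL (Fin 2) K, Matrix.ProjGenLinGroup.mk M = h :=
    QuotientGroup.mk_surjective h
  have hsmul : ∀ t : OnePoint K, (Matrix.ProjGenLinGroup.mk M : PGL(2, K)) • t = M • t :=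
    fun _ => rfl
  simp only [hsmul, OnePoint.smul_infty_eq_ite, OnePoint.smul_some_eq_ite] at hinf ⊢
  have hM : M 1 0 ≠ 0 := fun h => hinf (if_pos h)
  have hden : ∀ u : K, M 1 0 * u + M 1 1 = M 1 0 * (u - -(M 1 1 / M 1 0)) := fun u => by
    field_simp
    ring
  refine ⟨M 0 0 / M 1 0, -(M 1 1 / M 1 0), (M 0 1 - M 0 0 * (M 1 1 / M 1 0)) / M 1 0,
    if_neg hM, if_pos (by rw [hden, sub_self, mul_zero]), fun u hu => ?_⟩
  have hu' : u - -(M 1 1 / M 1 0) ≠ 0 := sub_ne_zero.2 hu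
  rw [hden, if_neg (mul_ne_zero hM hu')]
  congr 1
  generalize hP : -(M 1 1 / M 1 0) = P at hu'
  have hP' : M 1 1 / M 1 0 = -P := by rw [← hP, neg_neg]
  rw [hP']
  field_simp
  ring

variable {K : Type*} [DenselyNormedField K] [IsUltrametricDist K] [DecidableEq K]
  {D E T : ProjBall K} {h : PGL(2, K)}

theorem exists_smul_coe_eq_add_div_of_mapsTo (hD : ∞ ∉ D.closedBall) (hE : ∞ ∉ E.closedBall)
    (hmaps : MapsTo (fun x => h • x) D.openBallᶜ E.closedBall) :
    ∃ A P κ : K, ‖P - D.center‖ < D.radius ∧ ‖κ‖ ≤ E.radius * D.radius ∧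
      ∀ u : K, u ≠ P → h • (u : OnePoint K) = ((A + κ / (u - P) : K) : OnePoint K) := by
  have hinf : h • (∞ : OnePoint K) ∈ E.closedBall :=
    hmaps fun hmem => hD (D.openBall_subset_closedBall hmem)
  obtain ⟨A, P, κ, hA, hP, heq⟩ := exists_smul_coe_eq_add_div (ne_of_mem_of_not_mem hinf hE)
  have hPD : ‖P - D.center‖ < D.radius := by
    refine (ProjBall.mem_openBall_iff hD (coe_ne_infty P)).1 (by_contra fun hPmem => hE ?_)
    exact hP ▸ hmaps hPmem
  refine ⟨A, P, κ, hPD, ?_, heq⟩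
  suffices hκ : ∀ R ∈ Ioi D.radius, ‖κ‖ ≤ E.radius * R from
    ge_of_tendsto ((tendsto_id.const_mul E.radius).mono_left nhdsWithin_le_nhds)
      (eventually_of_mem self_mem_nhdsWithin hκ)
  intro R hR
  obtain ⟨e, hDe, heR⟩ := NormedField.exists_lt_norm_lt K D.radius_pos.le hR
  have hdist : ‖D.center + e - P‖ = ‖e‖ := by
    rw [norm_sub_eq_of_norm_sub_lt (z := D.center), add_sub_cancel_left]
    rw [add_sub_cancel_left]
    exact hPD.trans hDe
  have hpos : 0 < ‖D.center + e - P‖ := hdist ▸ D.radius_pos.trans hDe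
  have hmem : h • ((D.center + e : K) : OnePoint K) ∈ E.closedBall := hmaps <| by
    rw [mem_compl_iff, ProjBall.mem_openBall_iff hD (coe_ne_infty _), not_lt]
    simpa [coord] using hDe.le
  have hquot : ‖κ / (D.center + e - P)‖ ≤ E.radius := by
    rw [heq _ (sub_ne_zero.1 (norm_pos_iff.1 hpos))] at hmem
    rw [hA] at hinf
    simpa [coord] using ProjBall.norm_coord_sub_coord_le hE hmem hinf
  rw [norm_div, div_le_iff₀ hpos, hdist] at hquot
  exact hquot.trans (mul_le_mul_of_nonneg_left heR.le E.radius_pos.le)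

theorem norm_coord_smul_sub_coord_smul_le (hD : ∞ ∉ D.closedBall) (hE : ∞ ∉ E.closedBall)
    (hT : ∞ ∉ T.closedBall) (hDT : Disjoint D.closedBall T.closedBall)
    (hmaps : MapsTo (fun x => h • x) D.openBallᶜ E.closedBall) {x y : OnePoint K}
    (hx : x ∈ T.closedBall) (hy : y ∈ T.closedBall) :
    ‖coord (h • x) - coord (h • y)‖ ≤
      E.radius * D.radius / ‖D.center - T.center‖ ^ 2 * ‖coord x - coord y‖ := by
  obtain ⟨A, P, κ, hP, hκ, heq⟩ := exists_smul_coe_eq_add_div_of_mapsTo hD hE hmaps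
  have hlt : D.radius < ‖D.center - T.center‖ :=
    (le_max_left _ _).trans_lt (ProjBall.max_radius_lt hD hT hDT)
  have hdist : ∀ u : K, (u : OnePoint K) ∈ T.closedBall → ‖u - P‖ = ‖D.center - T.center‖ := by
    intro u hu
    have hcenter : ‖u - D.center‖ = ‖D.center - T.center‖ :=
      (norm_sub_rev _ _).trans (ProjBall.norm_center_sub_coord_eq hD hT hDT hu)
    rw [← hcenter]
    exact norm_sub_eq_of_norm_sub_lt (hP.trans (hcenter ▸ hlt))
  have hne : ∀ u : K, (u : OnePoint K) ∈ T.closedBall → u - P ≠ 0 := fun u hu =>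
    norm_pos_iff.1 (hdist u hu ▸ D.radius_pos.trans hlt)
  lift x to K using ne_of_mem_of_not_mem hx hT
  lift y to K using ne_of_mem_of_not_mem hy hT
  have hxP := hne x hx
  have hyP := hne y hy
  have hdiff : A + κ / (x - P) - (A + κ / (y - P)) = κ / ((x - P) * (y - P)) * (y - x) := by
    field_simp
    ring
  rw [heq x (sub_ne_zero.1 hxP), heq y (sub_ne_zero.1 hyP)]
  change ‖A + κ / (x - P) - (A + κ / (y - P))‖ ≤ _ * ‖x - y‖
  rw [hdiff, norm_mul, norm_div, norm_mul, hdist x hx, hdist y hy, ← sq, norm_sub_rev y x]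
  gcongr

end Moebius

section Words

variable {K : Type*} [NontriviallyNormedField K] {g : ℕ} {γ : Fin g → PGL(2, K)}

theorem letter_mem_grp (s : Fin g × Bool) : letter γ s ∈ grp γ := by
  have hmem : γ s.1 ∈ grp γ := Subgroup.subset_closure (mem_range_self _)
  rw [letter]
  split_ifs
  exacts [hmem, inv_mem hmem]

theorem wordSet_subset_grp (m : ℕ) : wordSet γ m ⊆ grp γ := by
  rintro _ ⟨w, -, -, rfl⟩
  refine Subgroup.list_prod_mem _ fun δ hδ => ?_
  obtain ⟨s, -, rfl⟩ := List.mem_map.1 hδ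
  exact letter_mem_grp s

theorem finite_setOf_mem_wordSet (γ : Fin g → PGL(2, K)) (m : ℕ) :
    {δ : grp γ | (δ : PGL(2, K)) ∈ wordSet γ m}.Finite :=
  (wordSet_finite γ m).preimage Subtype.val_injective.injOn

theorem sum_wordSet_eq_sum_subtype {M : Type*} [AddCommMonoid M] (f : PGL(2, K) → M) (m : ℕ) :
    ∑ δ ∈ (wordSet_finite γ m).toFinset, f δ =
      ∑ δ ∈ (finite_setOf_mem_wordSet γ m).toFinset, f δ := by
  refine (Finset.sum_nbij Subtype.val (fun δ hδ => by simpa using hδ)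
    Subtype.val_injective.injOn (fun δ hδ => ?_) fun _ _ => rfl).symm
  have hδm : δ ∈ wordSet γ m := by simpa using hδ
  exact ⟨⟨δ, wordSet_subset_grp m hδm⟩, by simpa using hδm, rfl⟩

theorem exists_isReduced_prod_eq {δ : PGL(2, K)} (hδ : δ ∈ grp γ) :
    ∃ w : List (Fin g × Bool), FreeGroup.IsReduced w ∧ (w.map (letter γ)).prod = δ := by
  rw [grp, ← FreeGroup.range_lift_eq_closure] at hδ
  obtain ⟨w, rfl⟩ := hδ
  refine ⟨w.toWord, FreeGroup.isReduced_toWord, ?_⟩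
  conv_rhs => rw [← FreeGroup.mk_toWord (x := w), FreeGroup.lift_mk]
  refine congrArg List.prod (List.map_congr_left fun s _ => ?_)
  rcases s with ⟨i, _ | _⟩ <;> rfl

theorem exists_isReduced_cons_prod_eq {δ : PGL(2, K)} (hδ : δ ∈ grp γ) {m : ℕ}
    (hδm : δ ∉ wordSet γ m) : ∃ s l, FreeGroup.IsReduced (s :: l) ∧ m ≤ l.length ∧
      ((s :: l).map (letter γ)).prod = δ := by
  obtain ⟨w, hw, rfl⟩ := exists_isReduced_prod_eq hδ
  have hlen : m < w.length := lt_of_not_ge fun hle => hδm ⟨w, hw, hle, rfl⟩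
  cases w with
  | nil => exact absurd hlen (Nat.not_lt_zero m)
  | cons s l => exact ⟨s, l, hw, Nat.le_of_lt_succ hlen, rfl⟩

/-- The index of the ball that receives the images under a letter: `B i` for `γᵢ`, and `B' i` for
`γᵢ⁻¹`. -/
def letterTarget (s : Fin g × Bool) : Fin g ⊕ Fin g :=
  if s.2 then .inl s.1 else .inr s.1

/-- The index of the ball whose complement a letter moves into its target: `B' i` for `γᵢ`, and
`B i` for `γᵢ⁻¹`. -/
def letterSource (s : Fin g × Bool) : Fin g ⊕ Fin g :=
  if s.2 then .inr s.1 else .inl s.1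

theorem letterSource_ne_letterTarget {s t : Fin g × Bool} (hst : s.1 = t.1 → s.2 = t.2) :
    letterSource s ≠ letterTarget t := by
  rcases s with ⟨i, _ | _⟩ <;> rcases t with ⟨j, _ | _⟩ <;>
    simp_all [letterSource, letterTarget]

end Words

section Domain

variable {K : Type*} [NontriviallyNormedField K] {g : ℕ} {B B' : Fin g → ProjBall K}
  {x : OnePoint K}

theorem mem_domain_iff : x ∈ domain B B' ↔ ∀ j, x ∉ (allBalls B B' j).openBall := by
  simp [domain]

theorem mem_domainInterior_iff :
    x ∈ domainInterior B B' ↔ ∀ j, x ∉ (allBalls B B' j).closedBall := by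
  simp [domainInterior]

end Domain

/-- The logarithmic derivative of `w ↦ thetaFactor a b w δ`, as an explicit rational function of
`w`. -/
noncomputable def logDerivThetaFactor {K : Type*} [NontriviallyNormedField K] [DecidableEq K]
    (a b : OnePoint K) (w : K) (δ : PGL(2, K)) : K :=
  (coord (δ • a) - coord (δ • b)) / ((w - coord (δ • a)) * (w - coord (δ • b)))

theorem rpow_neg_mul_sub_logb {p c d : ℝ} (hp : 1 < p) (hd : 0 < d) (m : ℕ) :
    p ^ (-(m : ℝ) * c - Real.logb p d) = (p ^ (-c)) ^ m / d := by
  have hp0 : 0 < p := one_pos.trans hp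
  rw [Real.rpow_sub hp0, Real.rpow_logb hp0 hp.ne' hd, ← Real.rpow_mul_natCast hp0.le,
    neg_mul_comm, mul_comm]

namespace IsGoodFundamentalDomain

section Dynamics

variable {K : Type*} [NontriviallyNormedField K] [DecidableEq K] {g : ℕ} {γ : Fin g → PGL(2, K)}
  {B B' : Fin g → ProjBall K} {x : OnePoint K}

theorem mem_domain_diff_infty_of_mem_diff (hF : IsGoodFundamentalDomain γ B B')
    (hinfty : ∞ ∈ domainInterior B B') {j : Fin g ⊕ Fin g}
    (hx : x ∈ (allBalls B B' j).closedBall \ (allBalls B B' j).openBall) :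
    x ∈ domain B B' \ {∞} := by
  refine ⟨mem_domain_iff.2 fun k hk => ?_,
    ne_of_mem_of_not_mem hx.1 (mem_domainInterior_iff.1 hinfty j)⟩
  obtain rfl | hjk := eq_or_ne j k
  · exact hx.2 hk
  · exact disjoint_left.1 (hF.disjoint hjk) hx.1 (ProjBall.openBall_subset_closedBall _ hk)

theorem smul_mem_diff (hF : IsGoodFundamentalDomain γ B B') {i : Fin g}
    (hx : x ∈ (B' i).closedBall \ (B' i).openBall) :
    γ i • x ∈ (B i).closedBall \ (B i).openBall := by
  obtain ⟨hclosed, hopen⟩ := hx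
  rw [← hF.image_inv i] at hclosed
  obtain ⟨y, hy, rfl⟩ := hclosed
  refine ⟨?_, by rwa [smul_inv_smul]⟩
  rw [← hF.image i]
  exact mem_image_of_mem _ hopen

theorem mapsTo_letter_closedBall (hF : IsGoodFundamentalDomain γ B B') (s : Fin g × Bool) :
    MapsTo (fun x => letter γ s • x) (allBalls B B' (letterSource s)).openBallᶜ
      (allBalls B B' (letterTarget s)).closedBall := by
  rcases s with ⟨i, _ | _⟩
  · exact mapsTo_iff_image_subset.2 (hF.image_inv i).subset
  · exact mapsTo_iff_image_subset.2 (hF.image i).subset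

theorem mapsTo_letter_openBall (hF : IsGoodFundamentalDomain γ B B') (s : Fin g × Bool) :
    MapsTo (fun x => letter γ s • x) (allBalls B B' (letterSource s)).closedBallᶜ
      (allBalls B B' (letterTarget s)).openBall := by
  rcases s with ⟨i, _ | _⟩
  · intro x hx
    by_contra hcon
    refine hx ((hF.image i).subset ⟨_, hcon, smul_inv_smul (γ i) x⟩)
  · intro x hx
    by_contra hcon
    refine hx ((hF.image_inv i).subset ⟨_, hcon, inv_smul_smul (γ i) x⟩)

theorem disjoint_source_target (hF : IsGoodFundamentalDomain γ B B') {s t : Fin g × Bool}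
    {l : List (Fin g × Bool)} (hw : FreeGroup.IsReduced (s :: t :: l)) :
    Disjoint (allBalls B B' (letterSource s)).closedBall
      (allBalls B B' (letterTarget t)).closedBall :=
  hF.disjoint (letterSource_ne_letterTarget (FreeGroup.isReduced_cons_cons.1 hw).1)

theorem prod_smul_mem_closedBall (hF : IsGoodFundamentalDomain γ B B') (hx : x ∈ domain B B')
    {s : Fin g × Bool} {l : List (Fin g × Bool)} (hw : FreeGroup.IsReduced (s :: l)) :
    ((s :: l).map (letter γ)).prod • x ∈ (allBalls B B' (letterTarget s)).closedBall := by
  induction l generalizing s with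
  | nil => simpa using hF.mapsTo_letter_closedBall s (mem_domain_iff.1 hx _)
  | cons t l ih =>
    have htail := ih (FreeGroup.isReduced_cons_cons.1 hw).2
    rw [List.map_cons, List.prod_cons, mul_smul]
    exact hF.mapsTo_letter_closedBall s fun hmem =>
      disjoint_left.1 (hF.disjoint_source_target hw) (ProjBall.openBall_subset_closedBall _ hmem)
        htail

theorem prod_smul_mem_openBall (hF : IsGoodFundamentalDomain γ B B') (hx : x ∈ domain B B')
    {s : Fin g × Bool} {l : List (Fin g × Bool)} (hw : FreeGroup.IsReduced (s :: l))
    (hl : l ≠ []) :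
    ((s :: l).map (letter γ)).prod • x ∈ (allBalls B B' (letterTarget s)).openBall := by
  obtain ⟨t, l, rfl⟩ := List.exists_cons_of_ne_nil hl
  have htail := hF.prod_smul_mem_closedBall hx (FreeGroup.isReduced_cons_cons.1 hw).2
  rw [List.map_cons, List.prod_cons, mul_smul]
  exact hF.mapsTo_letter_openBall s fun hmem =>
    disjoint_left.1 (hF.disjoint_source_target hw) hmem htail

theorem exists_mapsTo_domain_openBall (hF : IsGoodFundamentalDomain γ B B') {δ : PGL(2, K)}
    (hδ : δ ∈ grp γ) (hδ1 : δ ∉ wordSet γ 1) :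
    ∃ j, MapsTo (fun x => δ • x) (domain B B') (allBalls B B' j).openBall := by
  obtain ⟨s, l, hw, hlen, rfl⟩ := exists_isReduced_cons_prod_eq hδ hδ1
  exact ⟨letterTarget s, fun x hx => hF.prod_smul_mem_openBall hx hw (List.length_pos_iff.1 hlen)⟩

theorem smul_ne_infty (hF : IsGoodFundamentalDomain γ B B') (hinfty : ∞ ∈ domainInterior B B')
    (hx : x ∈ domain B B' \ {∞}) {δ : PGL(2, K)} (hδ : δ ∈ grp γ) : δ • x ≠ ∞ := by
  obtain ⟨w, hw, rfl⟩ := exists_isReduced_prod_eq hδ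
  cases w with
  | nil => simpa using hx.2
  | cons s l =>
    exact ne_of_mem_of_not_mem (hF.prod_smul_mem_closedBall hx.1 hw)
      (mem_domainInterior_iff.1 hinfty _)

end Dynamics

section Contraction

variable {K : Type*} [NontriviallyNormedField K] [DecidableEq K] {g : ℕ} {γ : Fin g → PGL(2, K)}
  {B B' : Fin g → ProjBall K}

theorem isContractionRate (hF : IsGoodFundamentalDomain γ B B')
    (hinfty : ∞ ∈ domainInterior B B') {p c : ℝ} (hp : 1 < p)
    (hc : IsLeast {t : ℝ | ∃ j k : Fin g ⊕ Fin g, j ≠ k ∧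
      t = (allBalls B B' j).treeDist p (allBalls B B' k)} c) :
    IsContractionRate (allBalls B B') (p ^ (-c)) := by
  have hinf := mem_domainInterior_iff.1 hinfty
  have hlt : ∀ j k, j ≠ k → max (allBalls B B' j).radius (allBalls B B' k).radius <
      ‖(allBalls B B' j).center - (allBalls B B' k).center‖ := fun j k hjk =>
    ProjBall.max_radius_lt (hinf j) (hinf k) (hF.disjoint hjk)
  refine ⟨by positivity, ?_, fun j k hjk =>
    ProjBall.radius_mul_radius_le hp (hlt j k hjk) (hc.2 ⟨j, k, hjk, rfl⟩)⟩
  obtain ⟨j, k, hjk, rfl⟩ := hc.1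
  exact Real.rpow_lt_one_of_one_lt_of_neg hp
    (neg_neg_of_pos (ProjBall.treeDist_pos hp (hlt j k hjk)))

end Contraction

section WordContraction

variable {K : Type*} [DenselyNormedField K] [IsUltrametricDist K] [DecidableEq K] {g : ℕ}
  {γ : Fin g → PGL(2, K)} {B B' : Fin g → ProjBall K} {x y : OnePoint K} {q : ℝ}

theorem norm_coord_letter_smul_sub_le (hF : IsGoodFundamentalDomain γ B B')
    (hinfty : ∞ ∈ domainInterior B B') (hq : IsContractionRate (allBalls B B') q)
    {s : Fin g × Bool} {j : Fin g ⊕ Fin g} (hj : letterSource s ≠ j)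
    (hx : x ∈ (allBalls B B' j).closedBall) (hy : y ∈ (allBalls B B' j).closedBall) {ε : ℝ}
    (hε : 0 ≤ ε) (hxy : ‖coord x - coord y‖ ≤ (allBalls B B' j).radius * ε) :
    ‖coord (letter γ s • x) - coord (letter γ s • y)‖ ≤
      (allBalls B B' (letterTarget s)).radius * (q * ε) := by
  have hinf := mem_domainInterior_iff.1 hinfty
  have hE := (allBalls B B' (letterTarget s)).radius_pos
  have hD := (allBalls B B' (letterSource s)).radius_pos
  have hrate := div_le_of_le_mul₀ (sq_nonneg _) hq.nonneg (hq.radius_mul_le _ _ hj)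
  calc ‖coord (letter γ s • x) - coord (letter γ s • y)‖
      ≤ (allBalls B B' (letterTarget s)).radius * (allBalls B B' (letterSource s)).radius /
          ‖(allBalls B B' (letterSource s)).center - (allBalls B B' j).center‖ ^ 2 *
          ‖coord x - coord y‖ :=
        norm_coord_smul_sub_coord_smul_le (hinf _) (hinf _) (hinf _) (hF.disjoint hj)
          (hF.mapsTo_letter_closedBall s) hx hy
    _ ≤ (allBalls B B' (letterTarget s)).radius * (allBalls B B' (letterSource s)).radius /
          ‖(allBalls B B' (letterSource s)).center - (allBalls B B' j).center‖ ^ 2 *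
          ((allBalls B B' j).radius * ε) := by gcongr
    _ = (allBalls B B' (letterTarget s)).radius * ((allBalls B B' (letterSource s)).radius *
          (allBalls B B' j).radius /
          ‖(allBalls B B' (letterSource s)).center - (allBalls B B' j).center‖ ^ 2 * ε) := by ring
    _ ≤ (allBalls B B' (letterTarget s)).radius * (q * ε) := by gcongr

theorem norm_coord_prod_smul_sub_le (hF : IsGoodFundamentalDomain γ B B')
    (hinfty : ∞ ∈ domainInterior B B') (hq : IsContractionRate (allBalls B B') q)
    (hx : x ∈ domain B B') (hy : y ∈ domain B B') {s : Fin g × Bool} {l : List (Fin g × Bool)}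
    (hw : FreeGroup.IsReduced (s :: l)) :
    ‖coord (((s :: l).map (letter γ)).prod • x) - coord (((s :: l).map (letter γ)).prod • y)‖ ≤
      (allBalls B B' (letterTarget s)).radius * q ^ l.length := by
  induction l generalizing s with
  | nil =>
    rw [List.length_nil, pow_zero, mul_one]
    exact ProjBall.norm_coord_sub_coord_le (mem_domainInterior_iff.1 hinfty _)
      (hF.prod_smul_mem_closedBall hx hw) (hF.prod_smul_mem_closedBall hy hw)
  | cons t l ih =>
    obtain ⟨hst, hwt⟩ := FreeGroup.isReduced_cons_cons.1 hw
    rw [List.map_cons, List.prod_cons, mul_smul, mul_smul, List.length_cons, pow_succ']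
    exact hF.norm_coord_letter_smul_sub_le hinfty hq (letterSource_ne_letterTarget hst)
      (hF.prod_smul_mem_closedBall hx hwt) (hF.prod_smul_mem_closedBall hy hwt)
      (pow_nonneg hq.nonneg _) (ih hwt)

theorem exists_mapsTo_domain_openBall_and_norm_coord_smul_sub_le
    (hF : IsGoodFundamentalDomain γ B B') (hinfty : ∞ ∈ domainInterior B B')
    (hq : IsContractionRate (allBalls B B') q) {m : ℕ} (hm : 1 ≤ m) {δ : PGL(2, K)}
    (hδ : δ ∈ grp γ) (hδm : δ ∉ wordSet γ m) :
    ∃ j, MapsTo (fun x => δ • x) (domain B B') (allBalls B B' j).openBall ∧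
      ∀ x ∈ domain B B', ∀ y ∈ domain B B',
        ‖coord (δ • x) - coord (δ • y)‖ ≤ (allBalls B B' j).radius * q ^ m := by
  obtain ⟨s, l, hw, hlen, rfl⟩ := exists_isReduced_cons_prod_eq hδ hδm
  have hl : l ≠ [] := List.length_pos_iff.1 (hm.trans hlen)
  refine ⟨letterTarget s, fun x hx => hF.prod_smul_mem_openBall hx hw hl, fun x hx y hy =>
    (hF.norm_coord_prod_smul_sub_le hinfty hq hx hy hw).trans ?_⟩
  exact mul_le_mul_of_nonneg_left (pow_le_pow_of_le_one hq.nonneg hq.lt_one.le hlen)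
    (ProjBall.radius_pos _).le

theorem tendsto_coord_smul_sub_coord_smul (hF : IsGoodFundamentalDomain γ B B')
    (hinfty : ∞ ∈ domainInterior B B') (hq : IsContractionRate (allBalls B B') q)
    (hx : x ∈ domain B B') (hy : y ∈ domain B B') :
    Tendsto (fun δ : grp γ => coord ((δ : PGL(2, K)) • x) - coord ((δ : PGL(2, K)) • y))
      cofinite (𝓝 0) := by
  obtain ⟨r, hr⟩ := (finite_range fun j => (allBalls B B' j).radius).bddAbove
  have hlim : Tendsto (fun m => r * q ^ m) atTop (𝓝 0) := by
    simpa using (tendsto_pow_atTop_nhds_zero_of_lt_one hq.nonneg hq.lt_one).const_mul r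
  rw [Metric.tendsto_nhds]
  intro ε hε
  obtain ⟨m, hmε, hm⟩ := ((hlim.eventually_lt_const hε).and (eventually_ge_atTop 1)).exists
  filter_upwards [(finite_setOf_mem_wordSet γ m).compl_mem_cofinite] with δ hδ
  obtain ⟨j, -, hle⟩ :=
    hF.exists_mapsTo_domain_openBall_and_norm_coord_smul_sub_le hinfty hq hm δ.2 hδ
  rw [dist_zero_right]
  exact (hle x hx y hy).trans_lt
    ((mul_le_mul_of_nonneg_right (hr ⟨j, rfl⟩) (pow_nonneg hq.nonneg m)).trans_lt hmε)

end WordContraction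

section ThetaSeries

theorem eventually_le_norm_sub_coord_smul {K : Type*} [NontriviallyNormedField K]
    [IsUltrametricDist K] [DecidableEq K] {g : ℕ} {γ : Fin g → PGL(2, K)}
    {B B' : Fin g → ProjBall K} {x : OnePoint K} {z : K} (hF : IsGoodFundamentalDomain γ B B')
    (hinfty : ∞ ∈ domainInterior B B') (hx : x ∈ domain B B' \ {∞})
    (hz : (z : OnePoint K) ∈ domain B B') (hzx : ∀ δ ∈ grp γ, δ • x ≠ (z : OnePoint K)) :
    ∀ᶠ ρ in 𝓝[>] (0 : ℝ), ∀ δ : grp γ, ρ ≤ ‖z - coord ((δ : PGL(2, K)) • x)‖ := by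
  have hradius : ∀ᶠ ρ in 𝓝[>] (0 : ℝ), ∀ j, ρ ≤ (allBalls B B' j).radius :=
    eventually_all.2 fun j => nhdsWithin_le_nhds (eventually_le_nhds (ProjBall.radius_pos _))
  have hshort : ∀ᶠ ρ in 𝓝[>] (0 : ℝ), ∀ δ ∈ {δ : grp γ | (δ : PGL(2, K)) ∈ wordSet γ 1},
      ρ ≤ ‖z - coord ((δ : PGL(2, K)) • x)‖ := by
    refine (eventually_all_finite (finite_setOf_mem_wordSet γ 1)).2 fun δ _ =>
      nhdsWithin_le_nhds (eventually_le_nhds (norm_pos_iff.2 (sub_ne_zero.2 fun h => ?_)))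
    exact hzx δ δ.2 (by rw [h, coe_coord (hF.smul_ne_infty hinfty hx δ.2)])
  filter_upwards [hradius, hshort] with ρ hρ hρshort δ
  by_cases hδ : (δ : PGL(2, K)) ∈ wordSet γ 1
  · exact hρshort δ hδ
  · obtain ⟨j, hj⟩ := hF.exists_mapsTo_domain_openBall δ.2 hδ
    exact (hρ j).trans (ProjBall.radius_le_norm_sub_coord (mem_domainInterior_iff.1 hinfty j)
      (mem_domain_iff.1 hz j) (hj hx.1))

variable {K : Type*} [DenselyNormedField K] [IsUltrametricDist K] [DecidableEq K] {g : ℕ}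
  {γ : Fin g → PGL(2, K)} {B B' : Fin g → ProjBall K} {a b : OnePoint K} {z : K} {q d : ℝ} {m : ℕ}

theorem norm_logDerivThetaFactor_le (hF : IsGoodFundamentalDomain γ B B')
    (hinfty : ∞ ∈ domainInterior B B') (hq : IsContractionRate (allBalls B B') q)
    (hd0 : 0 < d) (hd : ∀ j, d ≤ (allBalls B B' j).radius) (ha : a ∈ domain B B')
    (hb : b ∈ domain B B') (hz : (z : OnePoint K) ∈ domain B B') (hm : 1 ≤ m) {δ : PGL(2, K)}
    (hδ : δ ∈ grp γ) (hδm : δ ∉ wordSet γ m) : ‖logDerivThetaFactor a b z δ‖ ≤ q ^ m / d := by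
  obtain ⟨j, hmaps, hle⟩ :=
    hF.exists_mapsTo_domain_openBall_and_norm_coord_smul_sub_le hinfty hq hm hδ hδm
  have hfar : ∀ {x}, x ∈ domain B B' → (allBalls B B' j).radius ≤ ‖z - coord (δ • x)‖ := fun hx =>
    ProjBall.radius_le_norm_sub_coord (mem_domainInterior_iff.1 hinfty j) (mem_domain_iff.1 hz j)
      (hmaps hx)
  have hr := (allBalls B B' j).radius_pos
  have hqm := pow_nonneg hq.nonneg m
  calc ‖logDerivThetaFactor a b z δ‖
      ≤ (allBalls B B' j).radius * q ^ m /
          ((allBalls B B' j).radius * (allBalls B B' j).radius) := by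
        rw [logDerivThetaFactor, norm_div]
        gcongr
        exacts [hle a ha b hb, le_norm_mul hr (hfar ha) (hfar hb)]
    _ = q ^ m / (allBalls B B' j).radius := mul_div_mul_left _ _ hr.ne'
    _ ≤ q ^ m / d := by
        gcongr
        exact hd j

theorem norm_sum_sub_tsum_logDerivThetaFactor_le [CompleteSpace K]
    (hF : IsGoodFundamentalDomain γ B B') (hinfty : ∞ ∈ domainInterior B B')
    (hq : IsContractionRate (allBalls B B') q) (hd0 : 0 < d)
    (hd : ∀ j, d ≤ (allBalls B B' j).radius) (ha : a ∈ domain B B') (hb : b ∈ domain B B')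
    (hz : (z : OnePoint K) ∈ domain B B') {ρ : ℝ} (hρ : 0 < ρ)
    (hza : ∀ δ : grp γ, ρ ≤ ‖z - coord ((δ : PGL(2, K)) • a)‖)
    (hzb : ∀ δ : grp γ, ρ ≤ ‖z - coord ((δ : PGL(2, K)) • b)‖) (hm : 1 ≤ m) :
    ‖∑ δ ∈ (wordSet_finite γ m).toFinset, logDerivThetaFactor a b z δ -
      ∑' δ : grp γ, logDerivThetaFactor a b z δ‖ ≤ q ^ m / d := by
  have hdecay : Tendsto (fun δ : grp γ => logDerivThetaFactor a b z δ) cofinite (𝓝 0) :=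
    tendsto_div_cofinite_zero (hF.tendsto_coord_smul_sub_coord_smul hinfty hq ha hb)
      (mul_pos hρ hρ) fun δ => le_norm_mul hρ (hza δ) (hzb δ)
  rw [sum_wordSet_eq_sum_subtype]
  refine norm_sum_sub_tsum_le hdecay (div_nonneg (pow_nonneg hq.nonneg m) hd0.le) fun δ hδ => ?_
  exact hF.norm_logDerivThetaFactor_le hinfty hq hd0 hd ha hb hz hm δ.2 (by simpa using hδ)

end ThetaSeries

end IsGoodFundamentalDomain

end MumfordCurve

open MumfordCurve in
theorem proposition3p6_general {K : Type*} [DenselyNormedField K] [IsUltrametricDist K]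
    [CompleteSpace K] [DecidableEq K] {g : ℕ} {γ : Fin g → PGL(2, K)} {B B' : Fin g → ProjBall K}
    (hF : IsGoodFundamentalDomain γ B B') (hinfty : ∞ ∈ domainInterior B B')
    {p : ℝ} (hp : 1 < p) {c : ℝ}
    (hc : IsLeast {t : ℝ | ∃ j k : Fin g ⊕ Fin g, j ≠ k ∧
      t = (allBalls B B' j).treeDist p (allBalls B B' k)} c)
    {d : ℝ} (hd : IsLeast (Set.range fun j : Fin g ⊕ Fin g => (allBalls B B' j).diam) d)
    {a b : OnePoint K} (ha : a ∈ domain B B' \ {∞}) (hb : b ∈ domain B B' \ {∞})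
    {z : K} (hz : (z : OnePoint K) ∈ domain B B')
    (hza : ∀ δ ∈ grp γ, δ • a ≠ (z : OnePoint K)) (hzb : ∀ δ ∈ grp γ, δ • b ≠ (z : OnePoint K))
    {m : ℕ} (hm : 1 ≤ m) :
    (∀ δ ∈ grp γ, δ • a ≠ ∞ ∧ δ • b ≠ ∞) ∧
    (∀ᶠ w in 𝓝 z, Multipliable fun δ : grp γ => thetaFactor a b w δ) ∧
    DifferentiableAt K (theta γ a b) z ∧ theta γ a b z ≠ 0 ∧
    ‖∑ δ ∈ (wordSet_finite γ m).toFinset, logDerivThetaFactor a b z δ -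
        deriv (theta γ a b) z / theta γ a b z‖ ≤ p ^ (-(m : ℝ) * c - Real.logb p d) := by
  have hinf := mem_domainInterior_iff.1 hinfty
  obtain ⟨j₀, hj₀⟩ := hd.1
  have hd0 : 0 < d := hj₀ ▸ ProjBall.diam_pos (hinf j₀)
  have hdr j : d ≤ (allBalls B B' j).radius :=
    (hd.2 ⟨j, rfl⟩).trans (ProjBall.diam_le_radius (hinf j))
  have hq := hF.isContractionRate hinfty hp hc
  obtain ⟨ρ, ⟨hρa, hρb⟩, hρ⟩ := (((hF.eventually_le_norm_sub_coord_smul hinfty ha hz hza).and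
    (hF.eventually_le_norm_sub_coord_smul hinfty hb hz hzb)).and self_mem_nhdsWithin).exists
  have hab := hF.tendsto_coord_smul_sub_coord_smul hinfty hq ha.1 hb.1
  have hne : theta γ a b z ≠ 0 := tprod_div_ne_zero_of_tendsto hab hρ
    (fun δ => sub_ne_zero.1 (ne_zero_of_le_norm hρ (hρa δ))) hρb
  have hderiv : HasDerivAt (theta γ a b)
      (theta γ a b z * ∑' δ : grp γ, logDerivThetaFactor a b z δ) z :=
    hasDerivAt_tprod_div_of_tendsto hab hρ hρa hρb
  refine ⟨fun δ hδ => ⟨hF.smul_ne_infty hinfty ha hδ, hF.smul_ne_infty hinfty hb hδ⟩, ?_,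
    hderiv.differentiableAt, hne, ?_⟩
  · filter_upwards [Metric.ball_mem_nhds z hρ] with w hw
    exact multipliable_div_of_tendsto hab hρ fun δ => le_norm_sub_of_mem_ball (hρb δ) hw
  · rw [hderiv.deriv, mul_div_cancel_left₀ _ hne, rpow_neg_mul_sub_logb hp hd0]
    exact hF.norm_sum_sub_tsum_logDerivThetaFactor_le hinfty hq hd0 hdr ha.1 hb.1 hz hρ hρa hρb hm

theorem proposition3p6 {K : Type*} [NontriviallyNormedField K] [IsUltrametricDist K]
    [CompleteSpace K] [IsAlgClosed K] [DecidableEq K]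
    {g : ℕ} (γ : Fin g → PGL(2, K)) (B B' : Fin g → MumfordCurve.ProjBall K)
    (hF : MumfordCurve.IsGoodFundamentalDomain γ B B')
    (hinfty : (∞ : OnePoint K) ∈ MumfordCurve.domainInterior B B')
    (p : ℝ) (hp : 1 < p)
    (c : ℝ) (hc : IsLeast {t : ℝ | ∃ j k : Fin g ⊕ Fin g, j ≠ k ∧
      t = (MumfordCurve.allBalls B B' j).treeDist p (MumfordCurve.allBalls B B' k)} c)
    (d : ℝ) (hd : IsLeast (Set.range fun j : Fin g ⊕ Fin g =>
      (MumfordCurve.allBalls B B' j).diam) d)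
    (i : Fin g) (a : K)
    (ha : (a : OnePoint K) ∈ (B' i).closedBall \ (B' i).openBall)
    (z : K) (hz : (z : OnePoint K) ∈ MumfordCurve.domain B B')
    (hza : ∀ δ ∈ MumfordCurve.grp γ, δ • (a : OnePoint K) ≠ (z : OnePoint K))
    (m : ℕ) (hm : 1 ≤ m) :
    -- all the points `δa` are finite, so every term below has its literal meaning
    (∀ δ ∈ MumfordCurve.grp γ, δ • (a : OnePoint K) ≠ ∞) ∧
    -- the infinite product defining `u_{γᵢ}` converges near `z`
    (∀ᶠ w in 𝓝 z, Multipliable fun δ : MumfordCurve.grp γ =>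
      MumfordCurve.thetaFactor (a : OnePoint K) (γ i • (a : OnePoint K)) w δ) ∧
    DifferentiableAt K (MumfordCurve.uFun γ (γ i) (a : OnePoint K)) z ∧
    MumfordCurve.uFun γ (γ i) (a : OnePoint K) z ≠ 0 ∧
    ‖MumfordCurve.truncatedSum γ m (γ i) (a : OnePoint K) z -
        deriv (MumfordCurve.uFun γ (γ i) (a : OnePoint K)) z /
          MumfordCurve.uFun γ (γ i) (a : OnePoint K) z‖ ≤
      p ^ (-(m : ℝ) * c - Real.logb p d) := by
  let : DenselyNormedField K := ⟨fun _ _ => MumfordCurve.exists_lt_norm_lt⟩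
  have hzb : ∀ δ ∈ MumfordCurve.grp γ, δ • γ i • (a : OnePoint K) ≠ z := fun δ hδ =>
    mul_smul δ (γ i) (a : OnePoint K) ▸ hza _ (mul_mem hδ (Subgroup.subset_closure ⟨i, rfl⟩))
  obtain ⟨hfin, h⟩ := proposition3p6_general hF hinfty hp hc hd
    (hF.mem_domain_diff_infty_of_mem_diff (j := .inr i) hinfty ha)
    (hF.mem_domain_diff_infty_of_mem_diff (j := .inl i) hinfty (hF.smul_mem_diff ha))
    hz hza hzb hm
  exact ⟨fun δ hδ => (hfin δ hδ).1, h⟩
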